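/- Let $\varphi=\frac{1+\sqrt5}{2}$, let $\psi=\frac{1-\sqrt5}{2}$ be its algebraic conjugate, and for $x=m+n\varphi\in\mathbb Z[\varphi]$ ($m,n\in\mathbb Z$) write $x^\star=m+n\psi$. Let $\Gamma=\{(x,x^\star): x\in\mathbb Z[\varphi]\}$, a lattice in $\mathbb R\times\mathbb R$ which projects injectively to the first and densely to the second factor, let $W=(-1,\varphi-1]$, and let $\Omega=(\mathbb R\times\mathbb R)/\Gamma$, on which $\mathbb R$ acts by translation of the first coordinate. Then there is a unique $\mathbb R$-invariant Borel probability measure $\mathbb P$ on $\Omega$. The Fibonacci cut-and-project process is the map $\omega\mapsto p_\omega=\sum_{x\in\Lambda_\omega}\delta_x$ on $(\Omega,\mathbb P)$, where $$\Lambda_{[g,h]}=\{x+g : (x,y)\in\Gamma,\ y+h\in W\}.$$ It is a locally square-integrable invariant simple point process on $\mathbb R$, and it is number rigid: for every bounded Borel set $B\subset\mathbb R$ there is a conull set $\Omega_B\subset\Omega$ such that for $\omega\in\Omega_B$ the number $\#(\Lambda_\omega\cap B)=p_\omega(B)$ depends only on the restriction $p_\omega|_{B^c}$, i.e. for all $\omega,\omega'\in\Omega_B$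 with $p_\omega|_{B^c}=p_{\omega'}|_{B^c}$ one has $p_\omega(B)=p_{\omega'}(B)$. -/

import Mathlib

open MeasureTheory

/-- A pmp action: `P` is a probability measure on `Ω`, and every element of the additive group `G`
acts on `Ω` by a measure-preserving transformation. -/
structure IsInvariantProbability (G : Type*) {Ω : Type*} [AddGroup G] [AddAction G Ω]
    [MeasurableSpace Ω] (P : Measure Ω) : Prop where
  isProbability : IsProbabilityMeasure P
  invariant : ∀ t : G, MeasurePreserving (fun ω : Ω => t +ᵥ ω) P P

/-- `p : Ω → Measure G` is a locally square-integrable invariant simple point process defined over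
the pmp action of `G` on `(Ω, P)`. -/
structure IsInvariantPointProcess {G Ω : Type*} [NormedAddCommGroup G] [MeasurableSpace G]
    [BorelSpace G] [AddAction G Ω] [MeasurableSpace Ω] (P : Measure Ω) (p : Ω → Measure G) :
    Prop where
  invariantProbability : IsInvariantProbability G P
  measurable : Measurable p
  equivariant : ∀ (t : G) (ω : Ω), p (t +ᵥ ω) = (p ω).map (fun x => x + t)
  /-- Almost surely, `p ω` is the sum of the unit point masses at the points of a locally finite
  subset of `G`. -/
  simple : ∀ᵐ ω ∂P, ∃ S : Set G, (∀ K : Set G, IsCompact K → (S ∩ K).Finite) ∧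
    p ω = Measure.count.restrict S
  locallySquareIntegrable : ∀ B : Set G, MeasurableSet B → Bornology.IsBounded B →
    ∫⁻ ω, (p ω B) ^ 2 ∂P < ⊤

/-- Number rigidity: for every bounded Borel set `B` there is a conull set of `ω` on which the
number `p ω B` of points in `B` depends only on the restriction of `p ω` to the complement
of `B`. -/
def IsNumberRigid {G Ω : Type*} [NormedAddCommGroup G] [MeasurableSpace G] [MeasurableSpace Ω]
    (P : Measure Ω) (p : Ω → Measure G) : Prop :=
  ∀ B : Set G, MeasurableSet B → Bornology.IsBounded B →
    ∃ Ω₀ : Set Ω, P Ω₀ᶜ = 0 ∧ ∀ ω ∈ Ω₀, ∀ ω' ∈ Ω₀,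
      (p ω).restrict Bᶜ = (p ω').restrict Bᶜ → p ω B = p ω' B

/-- Parameters `(G, H, Γ, W)` of a cut-and-project process, for abelian `G` and `H`: a lattice
(discrete cocompact subgroup) `Γ` of `G × H` which projects injectively to `G` and densely to `H`,
and a non-empty, relatively compact (Borel) window `W ⊆ H` with dense interior. -/
structure CutAndProject (G H : Type*) [AddCommGroup G] [TopologicalSpace G]
    [AddCommGroup H] [TopologicalSpace H] [MeasurableSpace H] where
  Γ : AddSubgroup (G × H)
  W : Set H
  discrete : DiscreteTopology Γ
  cocompact : CompactSpace ((G × H) ⧸ Γ)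
  injOn_fst : Set.InjOn Prod.fst (Γ : Set (G × H))
  dense_snd : Dense (Prod.snd '' (Γ : Set (G × H)))
  nonempty_window : W.Nonempty
  measurableSet_window : MeasurableSet W
  relativelyCompact_window : IsCompact (closure W)
  dense_interior_window : W ⊆ closure (interior W)

namespace CutAndProject

variable {G H : Type*} [AddCommGroup G] [TopologicalSpace G]
  [AddCommGroup H] [TopologicalSpace H] [MeasurableSpace H]

/-- The parameter space `Ω = Γ \ (G × H)`. -/
def Hull (D : CutAndProject G H) : Type _ := (G × H) ⧸ D.Γ

instance (D : CutAndProject G H) : AddCommGroup D.Hull :=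
  inferInstanceAs (AddCommGroup ((G × H) ⧸ D.Γ))

instance (D : CutAndProject G H) : TopologicalSpace D.Hull :=
  inferInstanceAs (TopologicalSpace ((G × H) ⧸ D.Γ))

/-- The Borel sigma-algebra of the quotient topology. -/
instance (D : CutAndProject G H) : MeasurableSpace D.Hull := borel D.Hull

instance (D : CutAndProject G H) : BorelSpace D.Hull := ⟨rfl⟩

/-- The class `[g, h]` of `(g, h)` in the parameter space. -/
def toHull (D : CutAndProject G H) : G × H →+ D.Hull := QuotientAddGroup.mk' D.Γ

/-- `G` acts on the parameter space by translation of the first coordinate: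
`t • [g, h] = [t + g, h]`. -/
instance (D : CutAndProject G H) : AddAction G D.Hull where
  vadd t ω := D.toHull (t, 0) + ω
  zero_vadd ω := by
    change D.toHull (0, 0) + ω = ω
    rw [Prod.mk_zero_zero, map_zero, zero_add]
  add_vadd s t ω := by
    change D.toHull (s + t, 0) + ω = D.toHull (s, 0) + (D.toHull (t, 0) + ω)
    rw [← add_assoc, ← map_add, Prod.mk_add_mk, add_zero]

/-- The cut-and-project set `Λ(G, H, Γ, W) = pr_G (Γ ∩ (G × W))`. -/
def modelSet (Γ : AddSubgroup (G × H)) (W : Set H) : Set G :=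
  Prod.fst '' ((Γ : Set (G × H)) ∩ Set.univ ×ˢ W)

/-- The random point set `Λ_ω`, described without choosing a representative of `ω`;
see `pointSet_toHull`. -/
def pointSet (D : CutAndProject G H) (ω : D.Hull) : Set G :=
  {x | ∃ w ∈ D.W, D.toHull (x, w) = ω}

/-- `Λ_[g, h] = Λ(G, H, Γ, W - h) + g`. -/
theorem pointSet_toHull (D : CutAndProject G H) (g : G) (h : H) :
    D.pointSet (D.toHull (g, h)) =
      (fun x => x + g) '' modelSet D.Γ ((fun w => w - h) '' D.W) := by
  ext x
  constructor
  · rintro ⟨w, hw, hx⟩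
    have hmem : (x - g, w - h) ∈ D.Γ := by
      have h1 : D.toHull ((x, w) - (g, h)) = 0 := by rw [map_sub, hx, sub_self]
      exact (QuotientAddGroup.eq_zero_iff _).1 h1
    exact ⟨x - g, ⟨(x - g, w - h), ⟨hmem, trivial, w, hw, rfl⟩, rfl⟩, sub_add_cancel x g⟩
  · rintro ⟨_, ⟨⟨a, b⟩, ⟨hab, -, w, hw, hwb⟩, rfl⟩, rfl⟩
    refine ⟨w, hw, ?_⟩
    have h1 : D.toHull (a, b) = 0 := (QuotientAddGroup.eq_zero_iff _).2 hab
    have h2 : ((a + g, w) : G × H) = (a, b) + (g, h) := by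
      change w - h = b at hwb
      rw [Prod.mk_add_mk, ← hwb, sub_add_cancel]
    change D.toHull (a + g, w) = _
    rw [h2, map_add, h1, zero_add]

/-- The cut-and-project process `p(G, H, Γ, W)`: `p_ω` is the sum of the unit point masses at the
points of `Λ_ω`. -/
noncomputable def process [MeasurableSpace G] (D : CutAndProject G H) (ω : D.Hull) : Measure G :=
  Measure.count.restrict (D.pointSet ω)

end CutAndProject

open Real goldenRatio in
/-- The lattice `{(x, x⋆) : x ∈ ℤ[φ]}`, where `φ` is the golden ratio, `ψ` its algebraic
conjugate and `(m + n φ)⋆ = m + n ψ`. -/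
noncomputable def fibonacciLattice : AddSubgroup (ℝ × ℝ) where
  carrier := {v | ∃ m n : ℤ, v = (m + n * φ, m + n * ψ)}
  zero_mem' := ⟨0, 0, by ext <;> simp⟩
  add_mem' := by
    rintro _ _ ⟨m, n, rfl⟩ ⟨m', n', rfl⟩
    exact ⟨m + m', n + n', by ext <;> push_cast <;> simp <;> ring⟩
  neg_mem' := by
    rintro _ ⟨m, n, rfl⟩
    exact ⟨-m, -n, by ext <;> push_cast <;> simp <;> ring⟩

namespace fibonacciLattice

open Real goldenRatio

theorem int_eq_zero {m n : ℤ} {x : ℝ} (hx : Irrational x) (h : (m : ℝ) + n * x = 0) :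
    m = 0 ∧ n = 0 := by
  have hn : n = 0 := by
    by_contra hn
    exact ((hx.intCast_mul hn).intCast_add m).ne_zero h
  subst hn
  exact ⟨by simpa using h, rfl⟩

theorem discrete : DiscreteTopology fibonacciLattice := by
  refine discreteTopology_of_isOpen_singleton_zero ?_
  refine Metric.isOpen_singleton_iff.2 ⟨1, one_pos, ?_⟩
  rintro ⟨_, m, n, rfl⟩ h
  rw [Subtype.dist_eq, Prod.dist_eq, max_lt_iff] at h
  simp only [ZeroMemClass.coe_zero, Prod.fst_zero, Prod.snd_zero, Real.dist_eq, sub_zero] at h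
  have hprod : |((m + n * φ) * (m + n * ψ) : ℝ)| < 1 := by
    rw [abs_mul]
    nlinarith [h.1, h.2, abs_nonneg ((m : ℝ) + n * φ), abs_nonneg ((m : ℝ) + n * ψ)]
  have hint : ((m + n * φ) * (m + n * ψ) : ℝ) = ((m ^ 2 + m * n - n ^ 2 : ℤ) : ℝ) := by
    push_cast
    linear_combination (m * n : ℝ) * goldenRatio_add_goldenConj +
      (n ^ 2 : ℝ) * goldenRatio_mul_goldenConj
  have hzero : ((m + n * φ) * (m + n * ψ) : ℝ) = 0 := by
    rw [hint] at hprod ⊢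
    exact_mod_cast Int.abs_lt_one_iff.1 (by exact_mod_cast hprod)
  have hmn : m = 0 ∧ n = 0 := by
    rcases mul_eq_zero.1 hzero with h0 | h0
    · exact int_eq_zero goldenRatio_irrational h0
    · exact int_eq_zero goldenConj_irrational h0
  obtain ⟨rfl, rfl⟩ := hmn
  ext <;> simp

theorem cocompact : CompactSpace ((ℝ × ℝ) ⧸ fibonacciLattice) := by
  let f : ℝ × ℝ → (ℝ × ℝ) ⧸ fibonacciLattice :=
    fun u => QuotientAddGroup.mk (u.1 + u.2 * φ, u.1 + u.2 * ψ)
  have hf : Continuous f := continuous_quotient_mk'.comp (by fun_prop)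
  have hK : IsCompact (Set.Icc (0 : ℝ) 1 ×ˢ Set.Icc (0 : ℝ) 1) := isCompact_Icc.prod isCompact_Icc
  have hne : φ - ψ ≠ 0 := by
    rw [goldenRatio_sub_goldenConj]
    positivity
  refine ⟨?_⟩
  convert hK.image hf
  refine (Set.eq_univ_of_forall fun ω => ?_).symm
  induction ω using QuotientAddGroup.induction_on with
  | H v =>
    obtain ⟨a, b⟩ := v
    let t : ℝ := (a - b) / (φ - ψ)
    let s : ℝ := a - t * φ
    have ht : t * (φ - ψ) = a - b := div_mul_cancel₀ _ hne
    refine ⟨(Int.fract s, Int.fract t), ⟨⟨Int.fract_nonneg s, (Int.fract_lt_one s).le⟩,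
      ⟨Int.fract_nonneg t, (Int.fract_lt_one t).le⟩⟩, ?_⟩
    refine QuotientAddGroup.eq.2 ⟨⌊s⌋, ⌊t⌋, ?_⟩
    have hs : s = a - t * φ := rfl
    have h1 := Int.floor_add_fract s
    have h2 := Int.floor_add_fract t
    ext
    · simp only [Prod.fst_add, Prod.fst_neg]
      linear_combination hs - h1 - φ * h2
    · simp only [Prod.snd_add, Prod.snd_neg]
      linear_combination hs - h1 - ψ * h2 + ht

theorem injOn_fst : Set.InjOn Prod.fst (fibonacciLattice : Set (ℝ × ℝ)) := by
  rintro _ ⟨m, n, rfl⟩ _ ⟨m', n', rfl⟩ h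
  have h' : ((m - m' : ℤ) : ℝ) + ((n - n' : ℤ) : ℝ) * φ = 0 := by
    push_cast
    simp only at h
    linarith
  obtain ⟨h1, h2⟩ := int_eq_zero goldenRatio_irrational h'
  rw [sub_eq_zero.1 h1, sub_eq_zero.1 h2]

theorem dense_snd : Dense (Prod.snd '' (fibonacciLattice : Set (ℝ × ℝ))) := by
  have h : Irrational (ψ / 1) := by
    rw [div_one]
    exact goldenConj_irrational
  have hd := dense_addSubgroupClosure_pair_iff.2 h
  refine hd.mono ?_
  intro x hx
  obtain ⟨n, m, rfl⟩ := AddSubgroup.mem_closure_pair.1 hx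
  exact ⟨(m + n * φ, m + n * ψ), ⟨m, n, rfl⟩, by simp; ring⟩

end fibonacciLattice

open Real goldenRatio in
/-- The parameters of the Fibonacci cut-and-project process: the lattice
`{(x, x⋆) : x ∈ ℤ[φ]}` in `ℝ × ℝ` and the window `(-1, φ - 1]`. -/
noncomputable def fibonacci : CutAndProject ℝ ℝ where
  Γ := fibonacciLattice
  W := Set.Ioc (-1) (φ - 1)
  discrete := fibonacciLattice.discrete
  cocompact := fibonacciLattice.cocompact
  injOn_fst := fibonacciLattice.injOn_fst
  dense_snd := fibonacciLattice.dense_snd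
  nonempty_window := Set.nonempty_Ioc.2 (by linarith [goldenRatio_pos])
  measurableSet_window := measurableSet_Ioc
  relativelyCompact_window := by
    rw [closure_Ioc (by linarith [goldenRatio_pos] : (-1 : ℝ) < φ - 1).ne]
    exact isCompact_Icc
  dense_interior_window := by
    rw [interior_Ioc, closure_Ioo (by linarith [goldenRatio_pos] : (-1 : ℝ) < φ - 1).ne]
    exact Set.Ioc_subset_Icc_self

/-! The hull is a compact abelian group, and density of the projection of `Γ` to the second factor
makes the `ℝ`-orbit of `0` dense in it. By continuity an `ℝ`-invariant probability measure is
invariant under the whole group, so it is the normalized Haar measure.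

Differences of points of `Λ_ω ∩ B` come from lattice vectors in the bounded set `(B - B) × (W - W)`,
so the counts are bounded uniformly in `ω` and all moments are finite.

Rigidity holds in a strong form: for an interval window, the points outside a bounded set determine
`ω` itself (`eq_of_pointSet_sdiff_eq`). One common point outside `B` fixes `ω` up to its second
coordinate. Two candidates for that coordinate are separated by lattice vectors pushing one out of
the window and keeping the other in, and such vectors exist arbitrarily far away
(`exists_mem_lattice_notMem`). -/

namespace CutAndProject

/-! ### The hull as a compact group -/

section Topology

variable (D : CutAndProject ℝ ℝ)

theorem isClosed_lattice : IsClosed (D.Γ : Set (ℝ × ℝ)) := by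
  have := D.discrete
  exact AddSubgroup.isClosed_of_discrete

theorem countable_lattice : Countable D.Γ := by
  have := D.discrete
  exact TopologicalSpace.separableSpace_iff_countable.1 inferInstance

instance : CompactSpace D.Hull := D.cocompact

instance : IsTopologicalAddGroup D.Hull :=
  inferInstanceAs (IsTopologicalAddGroup ((ℝ × ℝ) ⧸ D.Γ))

instance : SecondCountableTopology D.Hull :=
  inferInstanceAs (SecondCountableTopology ((ℝ × ℝ) ⧸ D.Γ))

instance : T3Space D.Hull := by
  have : IsClosed (D.Γ : Set (ℝ × ℝ)) := D.isClosed_lattice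
  exact inferInstanceAs (T3Space ((ℝ × ℝ) ⧸ D.Γ))

theorem continuous_toHull : Continuous D.toHull := continuous_quotient_mk'

theorem toHull_surjective : Function.Surjective D.toHull := QuotientAddGroup.mk'_surjective D.Γ

theorem toHull_eq_zero {v : ℝ × ℝ} : D.toHull v = 0 ↔ v ∈ D.Γ := QuotientAddGroup.eq_zero_iff v

theorem toHull_eq_toHull {v w : ℝ × ℝ} : D.toHull v = D.toHull w ↔ v - w ∈ D.Γ := by
  rw [← D.toHull_eq_zero, map_sub, sub_eq_zero]

theorem vadd_hull_def (t : ℝ) (ω : D.Hull) : t +ᵥ ω = D.toHull (t, 0) + ω := rfl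

/-- For a closed subgroup of a Polish group, the quotient sigma-algebra is the Borel sigma-algebra
of the quotient topology. -/
theorem measurable_of_measurable_comp_toHull {β : Type*} [MeasurableSpace β] {f : D.Hull → β}
    (hf : Measurable fun v => f (D.toHull v)) : Measurable f := by
  have : IsClosed (D.Γ : Set (ℝ × ℝ)) := D.isClosed_lattice
  have hb : (inferInstance : MeasurableSpace ((ℝ × ℝ) ⧸ D.Γ)) = borel ((ℝ × ℝ) ⧸ D.Γ) :=
    BorelSpace.measurable_eq
  intro s hs
  have h1 : MeasurableSet[(inferInstance : MeasurableSpace ((ℝ × ℝ) ⧸ D.Γ))] (f ⁻¹' s) := hf hs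
  rw [hb] at h1
  exact h1

theorem finite_lattice_inter {S : Set (ℝ × ℝ)} (hS : Bornology.IsBounded S) :
    ((D.Γ : Set (ℝ × ℝ)) ∩ S).Finite := by
  have hd := D.discrete
  rw [Set.inter_comm]
  refine Metric.finite_isBounded_inter_isClosed ?_ hS D.isClosed_lattice
  exact ⟨hd⟩

theorem isBounded_window : Bornology.IsBounded D.W :=
  D.relativelyCompact_window.isBounded.subset subset_closure

/-- The orbit of `0` under `ℝ` is dense in the parameter space. -/
theorem dense_orbit_zero : Dense (Set.range fun t : ℝ => D.toHull (t, 0)) := by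
  -- Subtracting a lattice vector moves each point of this dense set to height `0`.
  have hs : Dense {v : ℝ × ℝ | v.2 ∈ Prod.snd '' (D.Γ : Set (ℝ × ℝ))} := by
    have := dense_univ.prod D.dense_snd (X := ℝ)
    refine this.mono ?_
    rintro v ⟨-, hv⟩
    exact hv
  refine (D.toHull_surjective.denseRange.dense_image D.continuous_toHull hs).mono ?_
  rintro _ ⟨⟨g, _⟩, ⟨⟨x, y⟩, hxy, rfl⟩, rfl⟩
  refine ⟨g - x, D.toHull_eq_toHull.2 ?_⟩
  simpa using D.Γ.neg_mem hxy

end Topology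

/-! ### Unique ergodicity -/

section InvariantMeasure

variable (D : CutAndProject ℝ ℝ)

/-- For continuous `f`, the function `a ↦ ∫ f (a + ω) dP` is continuous, and it is constant on the
dense orbit of `0`. -/
theorem isAddLeftInvariant_of_isInvariantProbability {P : Measure D.Hull}
    (hP : IsInvariantProbability ℝ P) : P.IsAddLeftInvariant := by
  have := hP.isProbability
  refine ⟨fun a => ?_⟩
  have hm (a : D.Hull) : Measurable fun ω : D.Hull => a + ω := (continuous_const_add a).measurable
  have (a : D.Hull) : IsProbabilityMeasure (P.map fun ω => a + ω) :=
    Measure.isProbabilityMeasure_map (hm a).aemeasurable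
  refine ext_of_forall_integral_eq_of_IsFiniteMeasure fun f => ?_
  have hmap (a : D.Hull) : ∫ ω, f ω ∂(P.map fun ω => a + ω) = ∫ ω, f (a + ω) ∂P :=
    integral_map (hm a).aemeasurable f.continuous.aestronglyMeasurable
  rw [hmap]
  have hc : Continuous fun a : D.Hull => ∫ ω, f (a + ω) ∂P := by
    refine continuous_of_dominated (bound := fun _ => ‖f‖) (fun a => ?_) (fun a => ?_)
      (integrable_const _) ?_
    · exact (f.continuous.comp (continuous_const_add a)).aestronglyMeasurable
    · exact Filter.Eventually.of_forall fun ω => f.norm_coe_le_norm _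
    · exact Filter.Eventually.of_forall fun ω => f.continuous.comp (continuous_add_const ω)
  refine congrFun (hc.ext_on D.dense_orbit_zero continuous_const ?_) a
  rintro _ ⟨t, rfl⟩
  have := (hP.invariant t).map_eq
  simp only [vadd_hull_def] at this
  change ∫ ω, f (D.toHull (t, 0) + ω) ∂P = ∫ ω, f ω ∂P
  rw [← hmap, this]

theorem exists_isInvariantProbability : ∃ P : Measure D.Hull, IsInvariantProbability ℝ P := by
  let K : TopologicalSpace.PositiveCompacts D.Hull := ⊤
  have hK : (K : Set D.Hull) = Set.univ := rfl
  refine ⟨Measure.addHaarMeasure K, ⟨?_⟩, fun t => ?_⟩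
  · rw [← hK, Measure.addHaarMeasure_self]
  · exact measurePreserving_add_left _ (D.toHull (t, 0))

theorem existsUnique_isInvariantProbability :
    ∃! P : Measure D.Hull, IsInvariantProbability ℝ P := by
  have isAddHaar {P : Measure D.Hull} (hP : IsInvariantProbability ℝ P) :
      P.IsAddHaarMeasure := by
    have := hP.isProbability
    have := D.isAddLeftInvariant_of_isInvariantProbability hP
    exact Measure.isAddHaarMeasure_of_isCompact_nonempty_interior P Set.univ isCompact_univ
      (by simp) (by simp) (by simp)
  obtain ⟨P, hP⟩ := D.exists_isInvariantProbability
  refine ⟨P, hP, fun Q hQ => ?_⟩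
  have := hP.isProbability
  have := hQ.isProbability
  have := isAddHaar hP
  have := isAddHaar hQ
  exact Measure.isAddHaarMeasure_eq_of_isProbabilityMeasure Q P

end InvariantMeasure

/-! ### Measurability, equivariance and moments -/

section PointProcess

variable (D : CutAndProject ℝ ℝ)

theorem pointSet_toHull_inter (v : ℝ × ℝ) (B : Set ℝ) :
    D.pointSet (D.toHull v) ∩ B =
      (fun γ : D.Γ => v.1 + (γ : ℝ × ℝ).1) '' {γ | v + (γ : ℝ × ℝ) ∈ B ×ˢ D.W} := by
  ext x
  constructor
  · rintro ⟨⟨w, hw, hx⟩, hxB⟩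
    refine ⟨⟨(x, w) - v, D.toHull_eq_toHull.1 hx⟩, ?_, ?_⟩
    · simpa using ⟨hxB, hw⟩
    · simp
  · rintro ⟨⟨γ, hγ⟩, ⟨hB, hW⟩, rfl⟩
    refine ⟨⟨(v + γ).2, hW, D.toHull_eq_toHull.2 ?_⟩, hB⟩
    convert hγ using 1
    ext <;> simp

theorem injective_add_fst_lattice (a : ℝ) :
    Function.Injective fun γ : D.Γ => a + (γ : ℝ × ℝ).1 := fun γ γ' h =>
  Subtype.ext (D.injOn_fst γ.2 γ'.2 (add_left_cancel h))

theorem countable_pointSet (ω : D.Hull) : (D.pointSet ω).Countable := by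
  have := D.countable_lattice
  obtain ⟨v, rfl⟩ := D.toHull_surjective ω
  rw [← Set.inter_univ (D.pointSet _), pointSet_toHull_inter]
  exact (Set.to_countable _).image _

theorem process_apply {B : Set ℝ} (hB : MeasurableSet B) (ω : D.Hull) :
    D.process ω B = (D.pointSet ω ∩ B).encard := by
  rw [process, Measure.restrict_apply hB, Set.inter_comm, Measure.count_apply]
  exact ((D.countable_pointSet ω).mono Set.inter_subset_left).measurableSet

theorem measurable_process : Measurable D.process := by
  refine Measure.measurable_of_measurable_coe _ fun B hB => ?_
  refine D.measurable_of_measurable_comp_toHull ?_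
  have := D.countable_lattice
  -- Injectivity of the first projection on `Γ` ensures that each point is counted by exactly one
  -- lattice vector.
  have h (v : ℝ × ℝ) : D.process (D.toHull v) B =
      ∑' γ : D.Γ, (B ×ˢ D.W).indicator 1 (v + (γ : ℝ × ℝ)) := by
    rw [D.process_apply hB, pointSet_toHull_inter,
      (D.injective_add_fst_lattice v.1).injOn.encard_image, ← ENNReal.tsum_set_one,
      tsum_subtype _ fun _ => (1 : ENNReal)]
    rfl
  simp_rw [h]
  refine Measurable.tsum fun γ => ?_
  exact (measurable_one.indicator (hB.prod D.measurableSet_window)).comp (measurable_add_const _)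

theorem pointSet_vadd (t : ℝ) (ω : D.Hull) :
    D.pointSet (t +ᵥ ω) = (fun x => x + t) '' D.pointSet ω := by
  have key (x w : ℝ) : D.toHull (x, w) = t +ᵥ ω ↔ D.toHull (x - t, w) = ω := by
    rw [vadd_hull_def, show ((x, w) : ℝ × ℝ) = (t, 0) + (x - t, w) by ext <;> simp, map_add,
      add_right_inj]
  ext x
  rw [Set.image_add_right]
  simp only [pointSet, key, Set.mem_ofPred_eq, Set.mem_preimage, sub_eq_add_neg]

theorem process_vadd (t : ℝ) (ω : D.Hull) :
    D.process (t +ᵥ ω) = (D.process ω).map fun x => x + t := by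
  ext B hB
  have ht : Measurable fun x : ℝ => x + t := measurable_add_const t
  rw [Measure.map_apply ht hB, D.process_apply hB, D.process_apply (ht hB), pointSet_vadd,
    ← Set.image_inter_preimage, (add_left_injective t).injOn.encard_image]

/-- The number of points of `Λ_ω` in a bounded set is bounded uniformly in `ω`. -/
theorem exists_encard_pointSet_inter_le {B : Set ℝ} (hB : Bornology.IsBounded B) :
    ∃ n : ℕ, ∀ ω : D.Hull, (D.pointSet ω ∩ B).encard ≤ n := by
  -- Subtracting one point `x₀` of the set embeds it into the first coordinates of this finite set,
  -- which does not depend on `ω`.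
  have hfin := D.finite_lattice_inter
    ((hB.sub hB).prod (D.isBounded_window.sub D.isBounded_window))
  refine ⟨(hfin.image Prod.fst).toFinset.card, fun ω => ?_⟩
  rcases (D.pointSet ω ∩ B).eq_empty_or_nonempty with h | ⟨x₀, ⟨w₀, hw₀, h₀⟩, hB₀⟩
  · simp [h]
  rw [← Set.encard_coe_eq_coe_finsetCard, Set.Finite.coe_toFinset,
    ← (sub_left_injective (b := x₀)).injOn.encard_image]
  refine Set.encard_le_encard ?_
  rintro _ ⟨x, ⟨⟨w, hw, hx⟩, hxB⟩, rfl⟩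
  exact ⟨(x, w) - (x₀, w₀), ⟨D.toHull_eq_toHull.1 (hx.trans h₀.symm),
    Set.sub_mem_sub hxB hB₀, Set.sub_mem_sub hw hw₀⟩, rfl⟩

theorem isInvariantPointProcess {P : Measure D.Hull} (hP : IsInvariantProbability ℝ P) :
    IsInvariantPointProcess P D.process where
  invariantProbability := hP
  measurable := D.measurable_process
  equivariant := D.process_vadd
  simple := by
    refine Filter.Eventually.of_forall fun ω => ⟨D.pointSet ω, fun K hK => ?_, rfl⟩
    obtain ⟨n, hn⟩ := D.exists_encard_pointSet_inter_le hK.isBounded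
    exact Set.finite_of_encard_le_coe (hn ω)
  locallySquareIntegrable := by
    intro B hB hBb
    have := hP.isProbability
    obtain ⟨n, hn⟩ := D.exists_encard_pointSet_inter_le hBb
    calc ∫⁻ ω, (D.process ω B) ^ 2 ∂P ≤ ∫⁻ _, (n : ENNReal) ^ 2 ∂P := by
          refine lintegral_mono fun ω => ?_
          rw [D.process_apply hB]
          gcongr
          exact_mod_cast ENat.toENNReal_le.2 (hn ω)
      _ < ⊤ := by simp

end PointProcess

/-! ### Reconstruction of `ω` from outside a bounded set -/

section Rigidity

variable (D : CutAndProject ℝ ℝ)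

theorem mem_pointSet_iff_process_singleton {ω : D.Hull} {x : ℝ} :
    x ∈ D.pointSet ω ↔ D.process ω {x} ≠ 0 := by
  rw [D.process_apply (measurableSet_singleton x), ne_eq, ENat.toENNReal_eq_zero,
    Set.encard_eq_zero, Set.inter_singleton_eq_empty, not_not]

theorem mem_pointSet_iff_of_restrict_eq {ω ω' : D.Hull} {B : Set ℝ}
    (h : (D.process ω).restrict Bᶜ = (D.process ω').restrict Bᶜ) {x : ℝ} (hx : x ∉ B) :
    x ∈ D.pointSet ω ↔ x ∈ D.pointSet ω' := by
  have key (η : D.Hull) : (D.process η).restrict Bᶜ {x} = D.process η {x} := by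
    rw [Measure.restrict_apply (measurableSet_singleton x),
      Set.inter_eq_left.2 (Set.singleton_subset_iff.2 hx)]
  rw [mem_pointSet_iff_process_singleton, mem_pointSet_iff_process_singleton, ← key, ← key, h]

/-- Lattice points in an open horizontal strip have unbounded first coordinates. -/
theorem exists_mem_lattice_notMem {B U : Set ℝ} (hB : Bornology.IsBounded B) (hU : IsOpen U)
    (hne : U.Nonempty) : ∃ v ∈ D.Γ, v.2 ∈ U ∧ v.1 ∉ B := by
  obtain ⟨y, hy⟩ := hne
  obtain ⟨ε, hε, hεU⟩ := Metric.isOpen_iff.1 hU y hy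
  have hfin := D.finite_lattice_inter (hB.prod (Metric.isBounded_ball (x := y) (r := ε)))
  obtain ⟨_, hz, ⟨v, hv, rfl⟩, hvn⟩ := (D.dense_snd.sdiff_finite
    (hfin.image Prod.snd)).inter_open_nonempty _ Metric.isOpen_ball ⟨y, Metric.mem_ball_self hε⟩
  exact ⟨v, hv, hεU hz, fun hvB => hvn ⟨v, ⟨hv, hvB, hz⟩, rfl⟩⟩

theorem mem_pointSet_toHull_add {x w : ℝ} {v : ℝ × ℝ} (hv : v ∈ D.Γ) :
    x + v.1 ∈ D.pointSet (D.toHull (x, w)) ↔ w + v.2 ∈ D.W := by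
  constructor
  · rintro ⟨w', hw', h⟩
    have h1 := D.Γ.sub_mem (D.toHull_eq_toHull.1 h) hv
    have h2 := D.injOn_fst h1 D.Γ.zero_mem (by simp)
    have h3 : w' - w - v.2 = 0 := congrArg Prod.snd h2
    rwa [show w + v.2 = w' by linarith]
  · intro h
    refine ⟨w + v.2, h, D.toHull_eq_toHull.2 ?_⟩
    convert hv using 1
    ext <;> simp

/-- For an interval window, the points of `Λ_ω` outside a bounded set determine `ω`. -/
theorem eq_of_pointSet_sdiff_eq {a b : ℝ} (hab : a < b) (hW : D.W = Set.Ioc a b) {B : Set ℝ}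
    (hB : Bornology.IsBounded B) {ω ω' : D.Hull}
    (h : ∀ x ∉ B, x ∈ D.pointSet ω ↔ x ∈ D.pointSet ω') : ω = ω' := by
  have step {x w w' : ℝ} (hw : w ∈ Set.Ioc a b) (hw' : w' ∈ Set.Ioc a b)
      (h : ∀ z ∉ B, z ∈ D.pointSet (D.toHull (x, w)) ↔ z ∈ D.pointSet (D.toHull (x, w'))) :
      w' ≤ w := by
    by_contra! hlt
    -- If `w < w'`, a height in `(a - w', a - w)` puts `w + v.2` below the window but keeps `w' +
    -- v.2` inside, since `w' - w < b - a`.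
    obtain ⟨v, hv, ⟨h1, h2⟩, hvB⟩ := D.exists_mem_lattice_notMem (hB.sub
      (Bornology.isBounded_singleton (x := x))) (isOpen_Ioo (a := a - w') (b := a - w))
      (Set.nonempty_Ioo.2 (by linarith))
    have hz := h (x + v.1) fun hmem => hvB ⟨_, hmem, x, rfl, by simp⟩
    rw [D.mem_pointSet_toHull_add hv, D.mem_pointSet_toHull_add hv, hW] at hz
    have := (hz.2 ⟨by linarith, by linarith [hw.1, hw'.2]⟩).1
    linarith
  obtain ⟨⟨g, k⟩, rfl⟩ := D.toHull_surjective ω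
  -- The height interval is the window shifted by `-k`, so `g + v.1` is a point of `Λ_ω` outside
  -- `B`. Being shared with `Λ_ω'`, it serves as first coordinate for representatives of both
  -- classes.
  obtain ⟨v, hv, ⟨h1, h2⟩, hvB⟩ := D.exists_mem_lattice_notMem (hB.sub
    (Bornology.isBounded_singleton (x := g))) (isOpen_Ioo (a := a - k) (b := b - k))
    (Set.nonempty_Ioo.2 (by linarith))
  have hxB : g + v.1 ∉ B := fun hmem => hvB ⟨_, hmem, g, rfl, by simp⟩
  have hx : g + v.1 ∈ D.pointSet (D.toHull (g, k)) := by
    rw [D.mem_pointSet_toHull_add hv, hW]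
    exact ⟨by linarith, by linarith⟩
  obtain ⟨w, hw, hwω⟩ := hx
  obtain ⟨w', hw', rfl⟩ := (h _ hxB).1 ⟨w, hw, hwω⟩
  rw [← hwω] at h ⊢
  rw [hW] at hw hw'
  rw [le_antisymm (step hw' hw fun z hz => (h z hz).symm) (step hw hw' h)]

theorem isNumberRigid {a b : ℝ} (hab : a < b) (hW : D.W = Set.Ioc a b) (P : Measure D.Hull) :
    IsNumberRigid P D.process := by
  intro B _ hBb
  refine ⟨Set.univ, by simp, fun ω _ ω' _ h => ?_⟩
  rw [D.eq_of_pointSet_sdiff_eq hab hW hBb fun x => D.mem_pointSet_iff_of_restrict_eq h]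

end Rigidity

end CutAndProject

open Real goldenRatio in
theorem mainTheorem11 :
    (∃! P : Measure fibonacci.Hull, IsInvariantProbability ℝ P) ∧
      ∀ P : Measure fibonacci.Hull, IsInvariantProbability ℝ P →
        IsInvariantPointProcess P fibonacci.process ∧ IsNumberRigid P fibonacci.process :=
  ⟨fibonacci.existsUnique_isInvariantProbability, fun P hP =>
    ⟨fibonacci.isInvariantPointProcess hP,
      fibonacci.isNumberRigid (by linarith [goldenRatio_pos] : (-1 : ℝ) < φ - 1) rfl P⟩⟩
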